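/- Let $\Gamma=(V,E)$ be a countable undirected graph without loops or multiple edges, and let $A_\Gamma^+$ be its right-angled Artin monoid, i.e. the monoid generated by $a_v$ $(v\in V)$ subject to the relations $a_va_w=a_wa_v$ whenever $(v,w)\in E$. For a right LCM monoid $S$, write $s\perp t$ if $sS\cap tS=\emptyset$. A finite set $F\subset S$ is a foundation set if for every $s\in S$ there is $f\in F$ with $f\not\perp s$; a set $F\subset S$ is accurate if $f\perp f'$ for all distinct $f,f'\in F$. Let $S_c=\{a\in S: a\not\perp s\text{ for all }s\in S\}$, and write $s\sim t$ if $sa=tb$ for some $a,b\in S_c$. A generalised scale on $S$ is a nontrivial homomorphism $N\colon S\to\mathbb N^\times$ to the multiplicative monoid of positive integers such that, for every $n\in N(S)$, one has $|N^{-1}(n)/_\sim|=n$ and every minimal complete set of representatives for $N^{-1}(n)/_\sim$ is an accurate foundation set for $S$. Let $V_u\subset V$ be the set of vertices that are adjacent to every other vertex. Let $(\Gamma_i)_{i\in I}$, $\Gamma_i=(V_i,E_i)$, be the coconnected components of $\Gamma$, i.e. the subgraphs induced on the connected components of the complementary graph, and let $I_2=\{i\in I:|V_i|\ge 2\}$.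 A family $(m_i)_{i\in J}$ of integers $m_i\geq 2$ is called rationally independent if $\prod_{i\in J}m_i^{k_i}\neq\prod_{i\in J}m_i^{k_i'}$ for all distinct finitely supported families $k,k'\in\bigoplus_{i\in J}\mathbb N$, where $0 \in \mathbb N$. Then $A_\Gamma^+$ admits a generalised scale if and only if the following three conditions hold: (1) $V_u\neq V$; (2) every coconnected component $\Gamma_i$ is finite and edge-free ($E_i=\emptyset$); (3) the family $(|V_i|)_{i\in I_2}$ is rationally independent. In this case, the generalised scale on $A_\Gamma^+$ is unique. -/

import Mathlib

/-! ### Foundation sets, the core relation and generalised scales of a monoid -/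

namespace GenScale

variable {S : Type*} [Monoid S]

/-- `s ⊥ t`: the principal right ideals `sS` and `tS` are disjoint. -/
def Orthogonal (s t : S) : Prop := ∀ x y : S, s * x ≠ t * y

/-- A finite set `F` such that no element of `S` is orthogonal to all members of `F`. -/
def IsFoundationSet (F : Set S) : Prop :=
  F.Finite ∧ ∀ s : S, ∃ f ∈ F, ¬ Orthogonal f s

/-- The members of `F` are pairwise orthogonal. -/
def IsAccurate (F : Set S) : Prop :=
  ∀ f ∈ F, ∀ f' ∈ F, f ≠ f' → Orthogonal f f'

variable (S) in
/-- The core `S_c`: the elements that are not orthogonal to any element of `S`. -/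
def core : Set S := {a | ∀ s : S, ¬ Orthogonal a s}

/-- The core relation `s ∼ t`: `sa = tb` for some `a, b` in the core.
It is an equivalence relation when `S` is right LCM, as right-angled Artin monoids are. -/
def CoreRel (s t : S) : Prop := ∃ a ∈ core S, ∃ b ∈ core S, s * a = t * b

/-- `T` contains exactly one representative of each class of `N⁻¹(n)/∼`, and nothing else. -/
def IsTransversal (N : S →* ℕ+) (n : ℕ+) (T : Set S) : Prop :=
  T ⊆ N ⁻¹' {n} ∧ ∀ s ∈ N ⁻¹' {n}, ∃! t, t ∈ T ∧ CoreRel s t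

/-- A generalised scale: a nontrivial homomorphism `N` to the multiplicative monoid of positive
integers such that, for each value `n` of `N`, the quotient `N⁻¹(n)/∼` has exactly `n` elements and
every transversal of it is an accurate foundation set for `S`.
(`Nat.card` being the positive number `n`, the quotient is finite.) -/
structure IsGeneralisedScale (N : S →* ℕ+) : Prop where
  nontrivial : N ≠ 1
  card_quot : ∀ n ∈ Set.range N,
    Nat.card (Quot fun s t : (N ⁻¹' {n} : Set S) => CoreRel (s : S) (t : S)) = (n : ℕ)
  transversal : ∀ n ∈ Set.range N, ∀ T : Set S, IsTransversal N n T →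
    IsAccurate T ∧ IsFoundationSet T

end GenScale

/-! ### Right-angled Artin monoids and the coconnected components of a graph -/

namespace SimpleGraph

variable {V : Type*} (Γ : SimpleGraph V)

/-- The defining relations `a_v a_w = a_w a_v` for adjacent `v, w`. -/
inductive RAArtinRel : FreeMonoid V → FreeMonoid V → Prop
  | comm (v w : V) (h : Γ.Adj v w) :
      RAArtinRel (FreeMonoid.of v * FreeMonoid.of w) (FreeMonoid.of w * FreeMonoid.of v)

/-- The right-angled Artin monoid `A_Γ⁺ = ⟨a_v, v ∈ V | a_v a_w = a_w a_v for adjacent v, w⟩⁺`,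
that is, the graph product over `Γ` of copies of the additive monoid `ℕ`. -/
abbrev RAArtinMonoid : Type _ := PresentedMonoid Γ.RAArtinRel

/-- The set `V_u` of universal vertices, those adjacent to every other vertex. -/
def universalVertices : Set V := {v | ∀ w, w ≠ v → Γ.Adj v w}

/-- The index set of the coconnected components of `Γ`: these are the subgraphs induced on the
connected components of the opposite (complementary) graph. -/
abbrev CoconnectedComponent : Type _ := Γᶜ.ConnectedComponent

/-- The graph `Γ_i` has no edges. -/
def CoconnectedComponent.EdgeFree {Γ : SimpleGraph V} (i : Γ.CoconnectedComponent) : Prop :=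
  Γ.induce i.supp = ⊥

/-- The index set `I₂` of the coconnected components with at least two vertices
(finite or infinite). -/
abbrev CoconnectedComponentTwo : Type _ :=
  {i : Γ.CoconnectedComponent // 2 ≤ i.supp.encard}

end SimpleGraph

/-- A family `m` of natural numbers is rationally independent if the products `∏ m_i ^ k_i` are
distinct for distinct finitely supported families `k` of exponents. -/
def RationallyIndependent {ι : Type*} (m : ι → ℕ) : Prop :=
  ∀ k k' : ι →₀ ℕ, k ≠ k' → (k.prod fun i e => m i ^ e) ≠ (k'.prod fun i e => m i ^ e)

namespace FreeMonoid

/-! The core is the central submonoid generated by the universal vertices, so `∼` is an equivalence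
relation, and any homomorphism killing those generators is an invariant of it (`map_eq_of_coreRel`).

Necessity. Accuracy of all transversals says that two elements of equal scale are either core
related or orthogonal. Hence the scale is 1 exactly on the core. The foundation property gives `N
a_w ∣ N a_v` for non-adjacent `v ≠ w` (`scale_dvd_of_not_adj`), so `N` is constant on generators of
a coconnected component. Adjacent vertices of one component would then be orthogonal, which is
absurd. The generators of a non-universal component thus form a full transversal, which forces `N
a_v = |V_i|` (`finite_and_scale_gen`) and gives finiteness and uniqueness. A multiplicative relation
between the sizes would yield commuting elements of equal scale that differ in letter counts.

Sufficiency. With edge-free components, an element modulo the core is a finitely supported family of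
words, one over each `V_i` with at least two vertices (`coreRel_iff_compProj_eq`). By rational
independence the scale determines the word lengths `k_i`, and there are `∏ |V_i| ^ k_i` families
with these lengths. Accuracy and the foundation property reduce to prefixes of words. -/

theorem of_mul_inj_left {α : Type*} {a b : α} {l l' : FreeMonoid α}
    (h : of a * l = of b * l') : a = b ∧ l = l' := by
  have h' : a :: l.toList = b :: l'.toList := congrArg toList h
  exact ⟨(List.cons.inj h').1, toList.injective (List.cons.inj h').2⟩

end FreeMonoid

/-! ### Orthogonality, core relation and transversals in a general monoid. -/

namespace GenScale

variable {S : Type*} [Monoid S]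

theorem not_orthogonal_iff {s t : S} : ¬ Orthogonal s t ↔ ∃ x y, s * x = t * y := by
  simp [Orthogonal]

theorem Orthogonal.of_map {T : Type*} [Monoid T] (f : S →* T) {s t : S}
    (h : Orthogonal (f s) (f t)) : Orthogonal s t :=
  fun x y e => h (f x) (f y) (by rw [← map_mul, ← map_mul, e])

theorem orthogonal_of_mul_of_mul {α : Type*} {a b : α} (hab : a ≠ b) (l l' : FreeMonoid α) :
    Orthogonal (FreeMonoid.of a * l) (FreeMonoid.of b * l') :=
  fun x y e => hab (FreeMonoid.of_mul_inj_left (by rwa [mul_assoc, mul_assoc] at e)).1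

theorem mem_core_of_mem_center {a : S} (h : a ∈ Submonoid.center S) : a ∈ core S :=
  fun s => not_orthogonal_iff.2 ⟨s, a, (Submonoid.mem_center_iff.1 h s).symm⟩

/-- If the core is a central submonoid, then the core relation is an equivalence relation. -/
theorem coreRel_equivalence {C : Submonoid S} (hC : core S = C) (hc : C ≤ Submonoid.center S) :
    Equivalence (CoreRel (S := S)) where
  refl s := ⟨1, hC ▸ C.one_mem, 1, hC ▸ C.one_mem, rfl⟩
  symm := fun ⟨a, ha, b, hb, e⟩ => ⟨b, hb, a, ha, e.symm⟩
  trans := by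
    rintro s t r ⟨a, ha, b, hb, e⟩ ⟨c, hc', d, hd, e'⟩
    rw [hC] at ha hb hc' hd
    refine ⟨a * c, hC ▸ C.mul_mem ha hc', d * b, hC ▸ C.mul_mem hd hb, ?_⟩
    rw [← mul_assoc, e, mul_assoc, Submonoid.mem_center_iff.1 (hc hc') b, ← mul_assoc, e',
      mul_assoc]

variable {N : S →* ℕ+} {n : ℕ+}

/-- Lets the transversal axiom be applied to chosen elements: a class meeting `A` is represented
from `A`, any other class arbitrarily. -/
theorem exists_isTransversal (hE : Equivalence (CoreRel (S := S))) {A : Set S}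
    (hA : A ⊆ N ⁻¹' {n}) (hAr : ∀ a ∈ A, ∀ b ∈ A, CoreRel a b → a = b) :
    ∃ T, A ⊆ T ∧ IsTransversal N n T := by
  classical
  let st : Setoid (N ⁻¹' {n} : Set S) :=
    ⟨fun s t => CoreRel (s : S) (t : S), fun s => hE.refl _, fun h => hE.symm h,
      fun h h' => hE.trans h h'⟩
  let r : (N ⁻¹' {n} : Set S) → (N ⁻¹' {n} : Set S) := fun s =>
    if h : ∃ a, a ∈ A ∧ CoreRel (s : S) a then ⟨h.choose, hA h.choose_spec.1⟩
    else Quotient.out (Quotient.mk st s)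
  have hr : ∀ s : (N ⁻¹' {n} : Set S), CoreRel (s : S) (r s : S) := fun s => by
    by_cases h : ∃ a, a ∈ A ∧ CoreRel (s : S) a
    · simp only [r, dif_pos h]; exact h.choose_spec.2
    · simp only [r, dif_neg h]; exact hE.symm (Quotient.mk_out (s := st) s)
  have hrr : ∀ s t : (N ⁻¹' {n} : Set S), CoreRel (s : S) (t : S) → r s = r t := fun s t hst => by
    by_cases h : ∃ a, a ∈ A ∧ CoreRel (s : S) a
    · have h' : ∃ a, a ∈ A ∧ CoreRel (t : S) a := ⟨h.choose, h.choose_spec.1,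
        hE.trans (hE.symm hst) h.choose_spec.2⟩
      simp only [r, dif_pos h, dif_pos h']
      exact Subtype.ext (hAr _ h.choose_spec.1 _ h'.choose_spec.1
        (hE.trans (hE.symm h.choose_spec.2) (hE.trans hst h'.choose_spec.2)))
    · have h' : ¬ ∃ a, a ∈ A ∧ CoreRel (t : S) a := fun ⟨a, ha, hta⟩ =>
        h ⟨a, ha, hE.trans hst hta⟩
      have e : Quotient.mk st s = Quotient.mk st t := Quotient.sound hst
      simp only [r, dif_neg h, dif_neg h', e]
  refine ⟨Set.range fun s => (r s : S), fun a ha => ⟨⟨a, hA ha⟩, ?_⟩, ?_, fun s hs => ?_⟩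
  · have h : ∃ b, b ∈ A ∧ CoreRel a b := ⟨a, ha, hE.refl a⟩
    simp only [r, dif_pos h]
    exact (hAr _ ha _ h.choose_spec.1 h.choose_spec.2).symm
  · rintro _ ⟨s, rfl⟩
    exact (r s).2
  · refine ⟨r ⟨s, hs⟩, ⟨⟨_, rfl⟩, hr ⟨s, hs⟩⟩, ?_⟩
    rintro _ ⟨⟨t, rfl⟩, ht⟩
    exact congrArg Subtype.val (hrr t ⟨s, hs⟩ (hE.trans (hr t) (hE.symm ht)))

theorem IsTransversal.eq_of_coreRel {T : Set S} (hE : Equivalence (CoreRel (S := S)))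
    (hT : IsTransversal N n T) {s t : S}
    (hs : s ∈ T) (ht : t ∈ T) (h : CoreRel s t) : s = t :=
  (hT.2 s (hT.1 hs)).unique ⟨hs, hE.refl s⟩ ⟨ht, h⟩

theorem IsTransversal.nat_card {T : Set S} (hE : Equivalence (CoreRel (S := S)))
    (hT : IsTransversal N n T) :
    Nat.card T =
      Nat.card (Quot fun s t : (N ⁻¹' {n} : Set S) => CoreRel (s : S) (t : S)) := by
  let st : Setoid (N ⁻¹' {n} : Set S) :=
    ⟨fun s t => CoreRel (s : S) (t : S), fun s => hE.refl _, fun h => hE.symm h,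
      fun h h' => hE.trans h h'⟩
  refine Nat.card_congr (Equiv.ofBijective (fun t => Quot.mk _ ⟨t.1, hT.1 t.2⟩) ⟨?_, ?_⟩)
  · intro s t h
    exact Subtype.ext (hT.eq_of_coreRel hE s.2 t.2 (Quotient.exact (s := st) h))
  · rintro ⟨s⟩
    obtain ⟨t, ⟨ht, hst⟩, -⟩ := hT.2 s s.2
    exact ⟨⟨t, ht⟩, Quot.sound (hE.symm hst)⟩

/-! ### Consequences of a generalised scale in a general monoid. -/

namespace IsGeneralisedScale

theorem nat_card_transversal (hN : IsGeneralisedScale N) (hE : Equivalence (CoreRel (S := S)))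
    {s : S} {T : Set S} (hT : IsTransversal N (N s) T) : Nat.card T = N s :=
  (hT.nat_card hE).trans (hN.card_quot _ ⟨s, rfl⟩)

/-- Elements of the same scale that are not core related are orthogonal. -/
theorem coreRel_of_not_orthogonal (hN : IsGeneralisedScale N)
    (hE : Equivalence (CoreRel (S := S))) {s t : S} (h : N s = N t) (hst : ¬ Orthogonal s t) :
    CoreRel s t := by
  by_contra hr
  -- If unrelated, `s` and `t` lie in a common transversal, which is accurate.
  obtain ⟨T, hAT, hT⟩ := exists_isTransversal (N := N) (n := N s) hE (A := {s, t})
    (by rintro _ (rfl | rfl) <;> simp [h])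
    (by
      rintro _ (rfl | rfl) _ (rfl | rfl) h
      exacts [rfl, (hr h).elim, (hr (hE.symm h)).elim, rfl])
  refine hst ((hN.transversal _ ⟨s, rfl⟩ T hT).1 s (hAT (by simp)) t (hAT (by simp)) ?_)
  rintro rfl
  exact hr (hE.refl s)

/-- A core element is orthogonal to nothing, so an accurate transversal containing it is a
singleton. -/
theorem map_eq_one_of_mem_core (hN : IsGeneralisedScale N)
    (hE : Equivalence (CoreRel (S := S))) {s : S} (hs : s ∈ core S) : N s = 1 := by
  obtain ⟨T, hAT, hT⟩ := exists_isTransversal (N := N) (n := N s) hE (A := {s})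
    (by simp) (by rintro _ rfl _ rfl h; rfl)
  have hT' : T = {s} := by
    refine Set.Subset.antisymm (fun t ht => ?_) hAT
    by_contra hne
    exact hs t ((hN.transversal _ ⟨s, rfl⟩ T hT).1 s (hAT rfl) t ht (Ne.symm hne))
  have := hN.nat_card_transversal hE hT
  rw [hT'] at this
  exact PNat.eq (by simpa using this.symm)

/-- Such an `s` is core related to `1`, so some multiple of `s` is in the core. -/
theorem mem_core_of_map_eq_one (hN : IsGeneralisedScale N)
    (hE : Equivalence (CoreRel (S := S))) {s : S} (hs : N s = 1) : s ∈ core S := by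
  have h1 : ¬ Orthogonal s 1 := not_orthogonal_iff.2 ⟨1, s, by simp⟩
  obtain ⟨a, -, b, hb, e⟩ := hN.coreRel_of_not_orthogonal hE (by simpa using hs) h1
  intro t
  obtain ⟨x, y, h⟩ := not_orthogonal_iff.1 (hb t)
  exact not_orthogonal_iff.2 ⟨a * x, y, by rw [← mul_assoc, e, one_mul, h]⟩

end IsGeneralisedScale

end GenScale

namespace SimpleGraph

variable {V : Type*} {Γ : SimpleGraph V}

/-! ### Universal vertices and coconnected components -/

theorem adj_of_connectedComponentMk_compl_ne {v w : V}
    (h : Γᶜ.connectedComponentMk v ≠ Γᶜ.connectedComponentMk w) : Γ.Adj v w := by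
  by_contra hvw
  refine h (ConnectedComponent.connectedComponentMk_eq_of_adj ?_)
  rw [compl_adj]
  exact ⟨fun e => h (by rw [e]), hvw⟩

theorem not_mem_universalVertices {v : V} :
    v ∉ Γ.universalVertices ↔ ∃ w, w ≠ v ∧ ¬ Γ.Adj v w := by
  simp [universalVertices]

theorem supp_eq_singleton_of_mem_universalVertices {v : V} (h : v ∈ Γ.universalVertices) :
    (Γᶜ.connectedComponentMk v).supp = {v} := by
  ext w
  rw [ConnectedComponent.mem_supp_iff, ConnectedComponent.eq, Set.mem_singleton_iff]
  constructor
  · rintro hw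
    obtain ⟨p⟩ := hw.symm
    cases p with
    | nil => rfl
    | cons hvu p => exact absurd (h _ hvu.1.symm) hvu.2
  · rintro rfl
    exact Reachable.refl _

theorem two_le_encard_supp_iff {v : V} :
    2 ≤ (Γᶜ.connectedComponentMk v).supp.encard ↔ v ∉ Γ.universalVertices := by
  constructor
  · intro h hv
    rw [supp_eq_singleton_of_mem_universalVertices hv, Set.encard_singleton] at h
    exact absurd h (by decide)
  · intro h
    obtain ⟨w, hwv, hvw⟩ := not_mem_universalVertices.1 h
    have hadj : Γᶜ.Adj v w := (compl_adj _ _ _).2 ⟨hwv.symm, hvw⟩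
    have : ({v, w} : Set V) ⊆ (Γᶜ.connectedComponentMk v).supp := by
      rintro _ (rfl | rfl)
      · rfl
      · exact (ConnectedComponent.connectedComponentMk_eq_of_adj hadj).symm
    rw [← Set.encard_pair hwv.symm]
    exact Set.encard_le_encard this

theorem CoconnectedComponent.EdgeFree.not_adj {i : Γ.CoconnectedComponent} (hi : i.EdgeFree)
    {v w : V} (hv : v ∈ i.supp) (hw : w ∈ i.supp) : ¬ Γ.Adj v w := by
  intro h
  have : (Γ.induce i.supp).Adj ⟨v, hv⟩ ⟨w, hw⟩ := h
  rw [show Γ.induce i.supp = ⊥ from hi] at this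
  exact this

/-! ### Generators and projections -/

variable (Γ) in
/-- The generator `a_v`. -/
abbrev gen (v : V) : Γ.RAArtinMonoid := PresentedMonoid.of Γ.RAArtinRel v

theorem gen_mul_gen {v w : V} (h : Γ.Adj v w) : Γ.gen v * Γ.gen w = Γ.gen w * Γ.gen v :=
  PresentedMonoid.mk_eq_mk_of_rel (RAArtinRel.comm v w h)

@[elab_as_elim]
theorem raArtin_induction {P : Γ.RAArtinMonoid → Prop} (one : P 1)
    (gen_mul : ∀ v s, P s → P (Γ.gen v * s)) (s : Γ.RAArtinMonoid) : P s := by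
  obtain ⟨l, rfl⟩ := PresentedMonoid.surjective_mk s
  induction l using FreeMonoid.recOn with
  | one => exact one
  | of_mul v l ih => rw [map_mul]; exact gen_mul v _ ih

/-- The homomorphism given by images of the generators with the required commutations. -/
def raArtinLift {M : Type*} [Monoid M] (f : V → M)
    (hf : ∀ v w, Γ.Adj v w → f v * f w = f w * f v) : Γ.RAArtinMonoid →* M :=
  PresentedMonoid.lift f (by rintro _ _ ⟨v, w, h⟩; simpa using hf v w h)

@[simp]
theorem raArtinLift_gen {M : Type*} [Monoid M] (f : V → M)
    (hf : ∀ v w, Γ.Adj v w → f v * f w = f w * f v) (v : V) :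
    raArtinLift f hf (Γ.gen v) = f v := rfl

open Classical in
/-- The projection onto the free monoid on two vertices that are not adjacent. -/
noncomputable def pairProj {v w : V} (h : ¬ Γ.Adj v w) : Γ.RAArtinMonoid →* FreeMonoid V :=
  raArtinLift (fun u => if u = v ∨ u = w then FreeMonoid.of u else 1) (by
    intro a b hab
    have : ¬ ((a = v ∨ a = w) ∧ (b = v ∨ b = w)) := by
      rintro ⟨rfl | rfl, rfl | rfl⟩
      exacts [hab.ne rfl, h hab, h hab.symm, hab.ne rfl]
    by_cases ha : a = v ∨ a = w <;> by_cases hb : b = v ∨ b = w <;> simp_all)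

theorem pairProj_left {v w : V} (h : ¬ Γ.Adj v w) :
    pairProj h (Γ.gen v) = FreeMonoid.of v := by simp [pairProj]

theorem pairProj_right {v w : V} (h : ¬ Γ.Adj v w) :
    pairProj h (Γ.gen w) = FreeMonoid.of w := by simp [pairProj]

theorem pairProj_other {v w u : V} (h : ¬ Γ.Adj v w) (hv : u ≠ v) (hw : u ≠ w) :
    pairProj h (Γ.gen u) = 1 := by simp [pairProj, hv, hw]

/-! ### The core of a right-angled Artin monoid -/

open GenScale

variable (Γ) in
/-- The submonoid generated by the universal vertices. -/
def universalSubmonoid : Submonoid Γ.RAArtinMonoid :=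
  Submonoid.closure (Γ.gen '' Γ.universalVertices)

theorem gen_mem_center {v : V} (hv : v ∈ Γ.universalVertices) :
    Γ.gen v ∈ Submonoid.center Γ.RAArtinMonoid := by
  rw [Submonoid.mem_center_iff]
  intro s
  induction s using raArtin_induction with
  | one => simp
  | gen_mul w s ih =>
    rcases eq_or_ne w v with rfl | h
    · rw [mul_assoc, ih]
    · rw [mul_assoc, ih, ← mul_assoc, ← gen_mul_gen (hv w h), mul_assoc]

theorem universalSubmonoid_le_center :
    Γ.universalSubmonoid ≤ Submonoid.center Γ.RAArtinMonoid :=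
  Submonoid.closure_le.2 (by rintro _ ⟨v, hv, rfl⟩; exact gen_mem_center hv)

/-- Take the first non-universal letter `v` and a vertex `w` not adjacent to it: the universal
letters before `v` vanish under the projection to `{v, w}`. -/
theorem mem_universalSubmonoid_or (s : Γ.RAArtinMonoid) :
    s ∈ Γ.universalSubmonoid ∨ ∃ v w, ∃ h : ¬ Γ.Adj v w, v ≠ w ∧
      ∃ l, pairProj h s = FreeMonoid.of v * l := by
  induction s using raArtin_induction with
  | one => exact .inl (one_mem _)
  | gen_mul u s ih =>
    by_cases hu : u ∈ Γ.universalVertices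
    · rcases ih with hs | ⟨v, w, h, hvw, l, hl⟩
      · exact .inl (mul_mem (Submonoid.subset_closure ⟨u, hu, rfl⟩) hs)
      · refine .inr ⟨v, w, h, hvw, l, ?_⟩
        rw [map_mul, pairProj_other h, one_mul, hl]
        · rintro rfl
          exact h (hu w hvw.symm)
        · rintro rfl
          exact h (hu v hvw).symm
    · obtain ⟨w, hwu, h⟩ := not_mem_universalVertices.1 hu
      exact .inr ⟨u, w, h, hwu.symm, pairProj h s, by rw [map_mul, pairProj_left]⟩

-- If the projection of `s` to `{v, w}` starts with `v`, then `s` is orthogonal to `a_w`, hence not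
-- in the core.
variable (Γ) in
theorem core_eq : core Γ.RAArtinMonoid = Γ.universalSubmonoid := by
  refine Set.Subset.antisymm (fun s hs => ?_)
    fun s hs => mem_core_of_mem_center (universalSubmonoid_le_center hs)
  refine (mem_universalSubmonoid_or s).resolve_right ?_
  rintro ⟨v, w, h, hvw, l, hl⟩
  refine hs (Γ.gen w) (Orthogonal.of_map (pairProj h) ?_)
  rw [hl, pairProj_right, ← mul_one (FreeMonoid.of w)]
  exact orthogonal_of_mul_of_mul hvw _ _

variable (Γ) in
theorem coreRel_equiv : Equivalence (CoreRel (S := Γ.RAArtinMonoid)) :=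
  coreRel_equivalence (core_eq Γ) universalSubmonoid_le_center

theorem map_eq_one_of_mem_core {M : Type*} [Monoid M] (f : Γ.RAArtinMonoid →* M)
    (hf : ∀ v ∈ Γ.universalVertices, f (Γ.gen v) = 1) {s : Γ.RAArtinMonoid}
    (hs : s ∈ core Γ.RAArtinMonoid) : f s = 1 := by
  rw [core_eq] at hs
  have : Γ.universalSubmonoid ≤ MonoidHom.mker f :=
    Submonoid.closure_le.2 (by rintro _ ⟨v, hv, rfl⟩; exact hf v hv)
  exact this hs

theorem map_eq_of_coreRel {M : Type*} [Monoid M] (f : Γ.RAArtinMonoid →* M)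
    (hf : ∀ v ∈ Γ.universalVertices, f (Γ.gen v) = 1) {s t : Γ.RAArtinMonoid}
    (h : CoreRel s t) : f s = f t := by
  obtain ⟨a, ha, b, hb, e⟩ := h
  simpa [map_eq_one_of_mem_core f hf ha, map_eq_one_of_mem_core f hf hb] using congrArg f e

theorem gen_mem_core {v : V} : Γ.gen v ∈ core Γ.RAArtinMonoid ↔ v ∈ Γ.universalVertices := by
  refine ⟨fun h => ?_, fun h => mem_core_of_mem_center (gen_mem_center h)⟩
  by_contra hv
  obtain ⟨w, hwv, hvw⟩ := not_mem_universalVertices.1 hv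
  refine h (Γ.gen w) (Orthogonal.of_map (pairProj hvw) ?_)
  rw [pairProj_left, pairProj_right]
  simpa using orthogonal_of_mul_of_mul hwv.symm 1 1

/-- An element orthogonal to `a_v` has a letter `w` not adjacent to `v` that comes before all
occurrences of `v`. -/
theorem exists_letter_of_orthogonal {v : V} (s : Γ.RAArtinMonoid)
    (hs : Orthogonal s (Γ.gen v)) :
    ∃ w, ∃ h : ¬ Γ.Adj v w, w ≠ v ∧ (∃ x y, s = x * Γ.gen w * y) ∧
      ∃ l, pairProj h s = FreeMonoid.of w * l := by
  induction s using raArtin_induction with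
  | one => exact (hs (Γ.gen v) 1 (by simp)).elim
  | gen_mul u s ih =>
    by_cases huv : u = v
    · subst huv
      exact (hs 1 s (mul_one _)).elim
    -- A letter adjacent to `v` commutes past `a_v`, so removing it preserves orthogonality; a
    -- non-adjacent letter is the one sought.
    by_cases hadj : Γ.Adj v u
    · have hs' : Orthogonal s (Γ.gen v) := fun x y e =>
        hs x (Γ.gen u * y) (by
          rw [mul_assoc, e, ← mul_assoc, ← mul_assoc, gen_mul_gen hadj])
      obtain ⟨w, h, hwv, ⟨x, y, e⟩, l, hl⟩ := ih hs'
      refine ⟨w, h, hwv, ⟨Γ.gen u * x, y, by rw [e]; simp only [mul_assoc]⟩, l, ?_⟩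
      rw [map_mul, pairProj_other h huv, one_mul, hl]
      rintro rfl
      exact h hadj
    · exact ⟨u, hadj, huv, ⟨1, s, by rw [one_mul]⟩, pairProj hadj s,
        by rw [map_mul, pairProj_right]⟩

/-! ### The number of letters in each coconnected component -/

open Classical in
variable (Γ) in
/-- The number of letters in each coconnected component with at least two vertices. -/
noncomputable def letterCount :
    Γ.RAArtinMonoid →* Multiplicative (Γ.CoconnectedComponentTwo →₀ ℕ) :=
  raArtinLift (fun v => Multiplicative.ofAdd
    (if h : 2 ≤ (Γᶜ.connectedComponentMk v).supp.encard then
      Finsupp.single ⟨Γᶜ.connectedComponentMk v, h⟩ 1 else 0)) fun _ _ _ => mul_comm _ _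

theorem letterCount_gen_of_mem {v : V} (h : v ∈ Γ.universalVertices) :
    Γ.letterCount (Γ.gen v) = 1 := by
  have h' : ¬ 2 ≤ (Γᶜ.connectedComponentMk v).supp.encard := fun h' =>
    two_le_encard_supp_iff.1 h' h
  simp only [letterCount, raArtinLift_gen, dif_neg h', ofAdd_zero]

theorem letterCount_gen {v : V} (i : Γ.CoconnectedComponentTwo) (h : v ∈ i.1.supp) :
    Γ.letterCount (Γ.gen v) = Multiplicative.ofAdd (Finsupp.single i 1) := by
  obtain ⟨i, hi⟩ := i
  obtain rfl : Γᶜ.connectedComponentMk v = i := h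
  simp only [letterCount, raArtinLift_gen, dif_pos hi]

/-- The product `∏ |V_i| ^ k_i`. -/
noncomputable def sizeProd (k : Γ.CoconnectedComponentTwo →₀ ℕ) : ℕ :=
  k.prod fun i e => i.1.supp.ncard ^ e

theorem sizeProd_add (k k' : Γ.CoconnectedComponentTwo →₀ ℕ) :
    sizeProd (k + k') = sizeProd k * sizeProd k' :=
  Finsupp.prod_add_index' (by simp) (by simp [pow_add])

/-- Universal letters are not counted, but they contribute only factors `1`. -/
theorem map_eq_sizeProd {N : Γ.RAArtinMonoid →* ℕ+}
    (hN : ∀ v, (N (Γ.gen v) : ℕ) = (Γᶜ.connectedComponentMk v).supp.ncard)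
    (s : Γ.RAArtinMonoid) : (N s : ℕ) = sizeProd (Γ.letterCount s).toAdd := by
  induction s using raArtin_induction with
  | one => simp [sizeProd]
  | gen_mul v s ih =>
    rw [map_mul, map_mul, PNat.mul_coe, toAdd_mul, sizeProd_add, ih, hN]
    congr 1
    by_cases hv : v ∈ Γ.universalVertices
    · simp [letterCount_gen_of_mem hv, supp_eq_singleton_of_mem_universalVertices hv, sizeProd]
    · rw [letterCount_gen (Γ := Γ) ⟨Γᶜ.connectedComponentMk v, two_le_encard_supp_iff.2 hv⟩ rfl,
        toAdd_ofAdd, sizeProd, Finsupp.prod_single_index (by simp), pow_one]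

/-- Elements of one commutative submonoid realise all letter counts. -/
theorem exists_letterCount_eq {v : Γ.CoconnectedComponentTwo → V} (hv : ∀ i, v i ∈ i.1.supp)
    (k : Γ.CoconnectedComponentTwo →₀ ℕ) :
    ∃ s ∈ Submonoid.closure (Set.range fun i => Γ.gen (v i)),
      Γ.letterCount s = Multiplicative.ofAdd k := by
  induction k using Finsupp.induction_linear with
  | zero => exact ⟨1, one_mem _, by simp⟩
  | add k k' h h' =>
    obtain ⟨s, hs, e⟩ := h
    obtain ⟨t, ht, e'⟩ := h'
    exact ⟨s * t, mul_mem hs ht, by rw [map_mul, e, e', ofAdd_add]⟩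
  | single i n =>
    refine ⟨Γ.gen (v i) ^ n, pow_mem (Submonoid.subset_closure (Set.mem_range_self i)) n, ?_⟩
    rw [map_pow, letterCount_gen i (hv i), ← ofAdd_nsmul]
    simp

/-! ### Properties of graphs whose monoid has a generalised scale -/

section Scale

variable {N : Γ.RAArtinMonoid →* ℕ+} (hN : IsGeneralisedScale N)
include hN

theorem scale_gen_eq_one_iff {v : V} : N (Γ.gen v) = 1 ↔ v ∈ Γ.universalVertices := by
  rw [← gen_mem_core]
  exact ⟨hN.mem_core_of_map_eq_one (coreRel_equiv Γ), hN.map_eq_one_of_mem_core (coreRel_equiv Γ)⟩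

theorem universalVertices_ne_univ_of_scale : Γ.universalVertices ≠ Set.univ := by
  intro h
  refine hN.nontrivial (PresentedMonoid.ext _ fun v => ?_)
  exact (scale_gen_eq_one_iff hN).2 (h ▸ Set.mem_univ v)

/-- A foundation set of scale `N a_v` containing `a_v` needs another member to meet `a_w a_v`, and
that member must contain the letter `w`. -/
theorem scale_dvd_of_not_adj {v w : V} (hvw : v ≠ w) (h : ¬ Γ.Adj v w) :
    N (Γ.gen w) ∣ N (Γ.gen v) := by
  obtain ⟨T, hvT, hT⟩ := exists_isTransversal (N := N) (n := N (Γ.gen v)) (coreRel_equiv Γ)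
    (A := {Γ.gen v}) (by simp) (by rintro _ rfl _ rfl h; rfl)
  replace hvT := hvT rfl
  obtain ⟨hacc, hf⟩ := hN.transversal _ ⟨_, rfl⟩ T hT
  -- The final `a_v` matters: were the letter of `f` blocking `a_v` some `u ≠ w`, the projection to
  -- `{v, u}` would send `a_w a_v` to `v` and `f` to a word starting with `u`.
  obtain ⟨f, hfT, hfs⟩ := hf.2 (Γ.gen w * Γ.gen v)
  have hfv : f ≠ Γ.gen v := by
    rintro rfl
    refine hfs (Orthogonal.of_map (pairProj h) ?_)
    rw [map_mul, pairProj_left, pairProj_right]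
    simpa using orthogonal_of_mul_of_mul hvw 1 (FreeMonoid.of v)
  obtain ⟨u, hu, huv, ⟨x, y, e⟩, l, hl⟩ :=
    exists_letter_of_orthogonal f (hacc f hfT _ hvT hfv)
  obtain rfl : u = w := by
    by_contra huw
    refine hfs (Orthogonal.of_map (pairProj hu) ?_)
    rw [hl, map_mul, pairProj_left, pairProj_other hu hvw.symm (Ne.symm huw), one_mul]
    simpa using orthogonal_of_mul_of_mul huv l 1
  have hNf : N f = N (Γ.gen v) := hT.1 hfT
  rw [← hNf, e, map_mul, map_mul]
  exact Dvd.intro_left (N x) rfl |>.mul_right _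

theorem scale_eq_of_connectedComponentMk_eq {v w : V}
    (h : Γᶜ.connectedComponentMk v = Γᶜ.connectedComponentMk w) :
    N (Γ.gen v) = N (Γ.gen w) := by
  obtain ⟨p⟩ := ConnectedComponent.exact h
  induction p with
  | nil => rfl
  | cons hadj p ih =>
    rw [compl_adj] at hadj
    refine (PNat.dvd_antisymm (scale_dvd_of_not_adj hN hadj.1.symm fun h => hadj.2 h.symm)
      (scale_dvd_of_not_adj hN hadj.1 hadj.2)).trans (ih (ConnectedComponent.sound p.reachable))

/-- The number of occurrences of a non-universal `v` is invariant under the core relation and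
separates `a_v` from `a_w`. -/
theorem orthogonal_gen_of_scale_eq {v w : V} (hv : v ∉ Γ.universalVertices) (hvw : v ≠ w)
    (h : N (Γ.gen v) = N (Γ.gen w)) : Orthogonal (Γ.gen v) (Γ.gen w) := by
  classical
  by_contra ho
  let f : Γ.RAArtinMonoid →* Multiplicative ℕ :=
    raArtinLift (fun u => Multiplicative.ofAdd (if u = v then 1 else 0)) fun _ _ _ => mul_comm _ _
  have hf : ∀ u ∈ Γ.universalVertices, f (Γ.gen u) = 1 := by
    intro u hu
    have : u ≠ v := by rintro rfl; exact hv hu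
    simp [f, this]
  have := map_eq_of_coreRel f hf (hN.coreRel_of_not_orthogonal (coreRel_equiv Γ) h ho)
  simp [f, hvw.symm] at this

theorem edgeFree_of_scale (i : Γ.CoconnectedComponent) : i.EdgeFree := by
  rw [CoconnectedComponent.EdgeFree, eq_bot_iff_forall_not_adj]
  rintro ⟨v, hv⟩ ⟨w, hw⟩ h
  replace h : Γ.Adj v w := h
  obtain rfl : Γᶜ.connectedComponentMk v = i := hv
  have hv : v ∉ Γ.universalVertices := fun hu => h.ne' <| by
    rwa [supp_eq_singleton_of_mem_universalVertices hu] at hw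
  exact orthogonal_gen_of_scale_eq hN hv h.ne
    (scale_eq_of_connectedComponentMk_eq hN (show Γᶜ.connectedComponentMk w = _ from hw).symm)
    _ _ (gen_mul_gen h)

theorem gen_injOn_of_scale {v : V} (hv : v ∉ Γ.universalVertices) :
    Set.InjOn Γ.gen (Γᶜ.connectedComponentMk v).supp := by
  rintro u hu w hw h
  by_contra huw
  have hu' : u ∉ Γ.universalVertices := by
    rw [← two_le_encard_supp_iff, show Γᶜ.connectedComponentMk u = _ from hu]
    exact two_le_encard_supp_iff.2 hv
  have := orthogonal_gen_of_scale_eq hN hu' huw (by rw [h])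
  exact this 1 1 (by rw [h])

theorem finite_and_scale_gen (v : V) : (Γᶜ.connectedComponentMk v).supp.Finite ∧
    (N (Γ.gen v) : ℕ) = (Γᶜ.connectedComponentMk v).supp.ncard := by
  by_cases hv : v ∈ Γ.universalVertices
  · simp [supp_eq_singleton_of_mem_universalVertices hv, (scale_gen_eq_one_iff hN).2 hv]
  set i := Γᶜ.connectedComponentMk v
  have hi : ∀ u ∈ i.supp, u ∉ Γ.universalVertices := fun u hu => by
    rw [← two_le_encard_supp_iff, show Γᶜ.connectedComponentMk u = _ from hu]
    exact two_le_encard_supp_iff.2 hv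
  have hNi : ∀ u ∈ i.supp, N (Γ.gen u) = N (Γ.gen v) := fun u hu =>
    scale_eq_of_connectedComponentMk_eq hN hu
  obtain ⟨T, hAT, hT⟩ := exists_isTransversal (N := N) (n := N (Γ.gen v)) (coreRel_equiv Γ)
    (A := Γ.gen '' i.supp) (by rintro _ ⟨u, hu, rfl⟩; exact hNi u hu) (by
      rintro _ ⟨u, hu, rfl⟩ _ ⟨w, hw, rfl⟩ h
      by_contra huw
      obtain ⟨a, -, b, -, e⟩ := h
      exact orthogonal_gen_of_scale_eq hN (hi u hu) (fun h => huw (by rw [h]))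
        ((hNi u hu).trans (hNi w hw).symm) a b e)
  -- A further member would be orthogonal to every generator of the component. Letters outside the
  -- component commute with these generators and can be stripped off; a letter inside contradicts
  -- orthogonality, and so does the empty word.
  have hTA : T = Γ.gen '' i.supp := by
    refine Set.Subset.antisymm (fun f hf => ?_) hAT
    by_contra hfA
    have hacc := (hN.transversal _ ⟨_, rfl⟩ T hT).1
    have ho : ∀ u ∈ i.supp, Orthogonal f (Γ.gen u) := fun u hu =>
      hacc f hf _ (hAT ⟨u, hu, rfl⟩) fun e => hfA ⟨u, hu, e.symm⟩
    clear hf hfA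
    induction f using raArtin_induction with
    | one => exact ho v rfl (Γ.gen v) 1 (by simp)
    | gen_mul w f ih =>
      by_cases hw : w ∈ i.supp
      · exact ho w hw 1 f (mul_one _)
      · refine ih fun u hu x y e => ho u hu x (Γ.gen w * y) ?_
        have hadj : Γ.Adj w u := adj_of_connectedComponentMk_compl_ne fun h => hw (h.trans hu)
        rw [mul_assoc, e, ← mul_assoc, gen_mul_gen hadj, mul_assoc]
  have hcard := hN.nat_card_transversal (coreRel_equiv Γ) hT
  have hinj := gen_injOn_of_scale hN hv
  rw [Nat.card_coe_set_eq, hTA, hinj.ncard_image] at hcard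
  -- `ncard` is `0` on infinite sets, whereas the scale is positive.
  exact ⟨Set.finite_of_ncard_pos (hcard ▸ PNat.pos _), hcard.symm⟩

/-- One vertex chosen in each component gives commuting generators. Equal products give commuting
`s`, `t` of equal scale; these are core related, so their letter counts agree. -/
theorem rationallyIndependent_of_scale :
    RationallyIndependent (fun i : Γ.CoconnectedComponentTwo => i.1.supp.ncard) := by
  intro k k' hk h
  choose v hv using fun i : Γ.CoconnectedComponentTwo => i.1.nonempty_supp
  obtain ⟨s, hs, es⟩ := exists_letterCount_eq hv k
  obtain ⟨t, ht, et⟩ := exists_letterCount_eq hv k'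
  have hcomm : s * t = t * s := by
    have := Submonoid.isMulCommutative_closure _ (s := Set.range fun i => Γ.gen (v i)) (by
      rintro _ ⟨i, rfl⟩ _ ⟨j, rfl⟩
      rcases eq_or_ne i j with rfl | hij
      · rfl
      · refine gen_mul_gen (adj_of_connectedComponentMk_compl_ne fun h => hij (Subtype.ext ?_))
        exact (hv i).symm.trans (h.trans (hv j)))
    exact congrArg Subtype.val (isMulCommutative_iff.1 this ⟨s, hs⟩ ⟨t, ht⟩)
  have hst : N s = N t := by
    have hNv := fun v => (finite_and_scale_gen hN v).2
    refine PNat.eq ?_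
    rw [map_eq_sizeProd hNv, map_eq_sizeProd hNv, es, et]
    exact h
  have := map_eq_of_coreRel Γ.letterCount (fun v hv => letterCount_gen_of_mem hv)
    (hN.coreRel_of_not_orthogonal (coreRel_equiv Γ) hst (not_orthogonal_iff.2 ⟨t, s, hcomm⟩))
  rw [es, et] at this
  exact hk (Multiplicative.ofAdd.injective this)

end Scale

theorem scale_unique {N N' : Γ.RAArtinMonoid →* ℕ+} (hN : IsGeneralisedScale N)
    (hN' : IsGeneralisedScale N') : N = N' := by
  refine PresentedMonoid.ext _ fun v => PNat.eq ?_
  exact (finite_and_scale_gen hN v).2.trans (finite_and_scale_gen hN' v).2.symm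

/-! ### Existence of the generalised scale -/

section Existence

variable (hG : ∀ i : Γ.CoconnectedComponent, i.EdgeFree)

open Classical in
/-- The projection onto the free monoid on the vertices of an edge-free coconnected component. -/
noncomputable def compProj (i : Γ.CoconnectedComponent) :
    Γ.RAArtinMonoid →* FreeMonoid i.supp :=
  raArtinLift (fun v => if h : v ∈ i.supp then FreeMonoid.of ⟨v, h⟩ else 1) (by
    intro v w hvw
    by_cases hv : v ∈ i.supp
    · have hw : w ∉ i.supp := fun hw => (hG i).not_adj hv hw hvw
      simp only [dif_neg hw, mul_one, one_mul]
    · simp only [dif_neg hv, mul_one, one_mul])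

theorem compProj_gen (i : Γ.CoconnectedComponent) (v : i.supp) :
    compProj hG i (Γ.gen v) = FreeMonoid.of v := by
  simp [compProj, -ConnectedComponent.mem_supp_iff]

theorem compProj_gen_of_notMem {i : Γ.CoconnectedComponent} {v : V} (h : v ∉ i.supp) :
    compProj hG i (Γ.gen v) = 1 := by
  simp only [compProj, raArtinLift_gen, dif_neg h]

theorem compProj_gen_of_mem_universalVertices (i : Γ.CoconnectedComponentTwo) {v : V}
    (h : v ∈ Γ.universalVertices) : compProj hG i.1 (Γ.gen v) = 1 := by
  refine compProj_gen_of_notMem hG fun hv => ?_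
  obtain ⟨i, hi⟩ := i
  obtain rfl : Γᶜ.connectedComponentMk v = i := hv
  exact two_le_encard_supp_iff.1 hi h

theorem length_compProj (i : Γ.CoconnectedComponentTwo) (s : Γ.RAArtinMonoid) :
    (compProj hG i.1 s).length = (Γ.letterCount s).toAdd i := by
  induction s using raArtin_induction with
  | one => simp
  | gen_mul v s ih =>
    rw [map_mul, map_mul, toAdd_mul, FreeMonoid.length_mul, Finsupp.add_apply, ih]
    congr 1
    by_cases hv : v ∈ i.1.supp
    · rw [compProj_gen hG i.1 ⟨v, hv⟩, letterCount_gen i hv]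
      simp
    · rw [compProj_gen_of_notMem hG hv]
      by_cases hu : v ∈ Γ.universalVertices
      · rw [letterCount_gen_of_mem hu]; simp
      · have hne : (⟨Γᶜ.connectedComponentMk v, two_le_encard_supp_iff.2 hu⟩ :
            Γ.CoconnectedComponentTwo) ≠ i := fun e => hv (congrArg Subtype.val e)
        rw [letterCount_gen (Γ := Γ) ⟨Γᶜ.connectedComponentMk v, two_le_encard_supp_iff.2 hu⟩ rfl]
        simp [hne]

/-- The letters before the first letter from `V_i` lie in other components and commute past it. -/
theorem exists_eq_gen_mul (i : Γ.CoconnectedComponent) (v : i.supp) (l : FreeMonoid i.supp)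
    (s : Γ.RAArtinMonoid) (h : compProj hG i s = FreeMonoid.of v * l) :
    ∃ t, s = Γ.gen v * t := by
  induction s using raArtin_induction with
  | one => exact absurd (congrArg FreeMonoid.length h) (by simp; omega)
  | gen_mul w s ih =>
    by_cases hw : w ∈ i.supp
    · rw [map_mul, compProj_gen hG i ⟨w, hw⟩] at h
      obtain rfl := (FreeMonoid.of_mul_inj_left h).1
      exact ⟨s, rfl⟩
    · rw [map_mul, compProj_gen_of_notMem hG hw, one_mul] at h
      obtain ⟨t, rfl⟩ := ih h
      have hadj : Γ.Adj w v := adj_of_connectedComponentMk_compl_ne fun h => hw (h.trans v.2)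
      exact ⟨Γ.gen w * t, by rw [← mul_assoc, ← mul_assoc, gen_mul_gen hadj]⟩

theorem mem_core_of_compProj_eq_one (s : Γ.RAArtinMonoid)
    (h : ∀ i : Γ.CoconnectedComponentTwo, compProj hG i.1 s = 1) : s ∈ core Γ.RAArtinMonoid := by
  rw [core_eq]
  induction s using raArtin_induction with
  | one => exact one_mem _
  | gen_mul v s ih =>
    have key : ∀ i : Γ.CoconnectedComponentTwo,
        compProj hG i.1 (Γ.gen v) = 1 ∧ compProj hG i.1 s = 1 := fun i => by
      have := congrArg FreeMonoid.length (h i)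
      rw [map_mul, FreeMonoid.length_mul, FreeMonoid.length_one, Nat.add_eq_zero_iff] at this
      exact ⟨FreeMonoid.length_eq_zero.1 this.1, FreeMonoid.length_eq_zero.1 this.2⟩
    refine mul_mem (Submonoid.subset_closure ⟨v, ?_, rfl⟩) (ih fun i => (key i).2)
    by_contra hv
    have := (key ⟨Γᶜ.connectedComponentMk v, two_le_encard_supp_iff.2 hv⟩).1
    rw [compProj_gen hG _ ⟨v, rfl⟩] at this
    exact absurd (congrArg FreeMonoid.length this) (by simp)

/-- Induction on `s`: a universal first letter is absorbed by the core; any other can be pulled to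
the front of `t` and cancelled in the projections. -/
theorem coreRel_of_compProj_eq (s t : Γ.RAArtinMonoid)
    (h : ∀ i : Γ.CoconnectedComponentTwo, compProj hG i.1 s = compProj hG i.1 t) :
    CoreRel s t := by
  have h1 : (1 : Γ.RAArtinMonoid) ∈ core Γ.RAArtinMonoid := by rw [core_eq]; exact one_mem _
  induction s using raArtin_induction generalizing t with
  | one =>
    exact ⟨t, mem_core_of_compProj_eq_one hG t fun i => by rw [← h i, map_one], 1, h1, by simp⟩
  | gen_mul v s ih =>
    by_cases hv : v ∈ Γ.universalVertices
    · refine (coreRel_equiv Γ).trans ⟨1, h1, Γ.gen v, gen_mem_core.2 hv, ?_⟩ (ih t fun i => ?_)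
      · rw [mul_one, Submonoid.mem_center_iff.1 (gen_mem_center hv)]
      · rw [← h i, map_mul, compProj_gen_of_mem_universalVertices hG i hv, one_mul]
    · have hi := h ⟨Γᶜ.connectedComponentMk v, two_le_encard_supp_iff.2 hv⟩
      rw [map_mul, compProj_gen hG _ ⟨v, rfl⟩] at hi
      obtain ⟨t, rfl⟩ := exists_eq_gen_mul hG _ _ _ t hi.symm
      obtain ⟨a, ha, b, hb, e⟩ := ih t fun i => by
        have := h i
        rw [map_mul, map_mul] at this
        exact mul_left_cancel this
      exact ⟨a, ha, b, hb, by rw [mul_assoc, e, mul_assoc]⟩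

theorem coreRel_iff_compProj_eq {s t : Γ.RAArtinMonoid} :
    CoreRel s t ↔ ∀ i : Γ.CoconnectedComponentTwo, compProj hG i.1 s = compProj hG i.1 t :=
  ⟨fun h i => map_eq_of_coreRel _
    (fun _ hv => compProj_gen_of_mem_universalVertices hG i hv) h, coreRel_of_compProj_eq hG s t⟩

/-- Multiply lifts of the words `l i`; each lift is invisible to the other components. -/
theorem exists_compProj_eq_on (l : ∀ i : Γ.CoconnectedComponentTwo, FreeMonoid i.1.supp)
    (A : Finset Γ.CoconnectedComponentTwo) :
    ∃ s, (∀ i ∈ A, compProj hG i.1 s = l i) ∧ ∀ i ∉ A, compProj hG i.1 s = 1 := by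
  classical
  induction A using Finset.induction_on with
  | empty => exact ⟨1, by simp, by simp⟩
  | insert j A hj ih =>
    obtain ⟨s, hs, hs'⟩ := ih
    have h1 : ∀ l : FreeMonoid j.1.supp,
        compProj hG j.1 (FreeMonoid.lift (fun v => Γ.gen v.1) l) = l := fun l => by
      refine DFunLike.congr_fun (f := (compProj hG j.1).comp (FreeMonoid.lift _))
        (g := MonoidHom.id _) (FreeMonoid.hom_eq fun v => ?_) l
      simp [compProj_gen]
    have h2 : ∀ i ≠ j, ∀ l : FreeMonoid j.1.supp,
        compProj hG i.1 (FreeMonoid.lift (fun v => Γ.gen v.1) l) = 1 := fun i hi l => by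
      refine DFunLike.congr_fun (f := (compProj hG i.1).comp (FreeMonoid.lift _))
        (g := 1) (FreeMonoid.hom_eq fun v => ?_) l
      have : v.1 ∉ i.1.supp := fun h => hi (Subtype.ext (Eq.trans (Eq.symm h) v.2))
      simp [compProj_gen_of_notMem hG this]
    refine ⟨FreeMonoid.lift (fun v => Γ.gen v.1) (l j) * s, fun i hi => ?_, fun i hi => ?_⟩
    · rw [map_mul]
      rcases eq_or_ne i j with rfl | hij
      · rw [h1, hs' _ hj, mul_one]
      · rw [h2 i hij, one_mul, hs i ((Finset.mem_insert.1 hi).resolve_left hij)]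
    · rw [Finset.mem_insert, not_or] at hi
      rw [map_mul, h2 i hi.1, one_mul, hs' i hi.2]

/-- All families of words whose lengths are bounded by letter counts are families of
projections. -/
theorem exists_compProj_eq (l : ∀ i : Γ.CoconnectedComponentTwo, FreeMonoid i.1.supp)
    (k : Γ.CoconnectedComponentTwo →₀ ℕ) (hl : ∀ i, (l i).length ≤ k i) :
    ∃ s, ∀ i, compProj hG i.1 s = l i := by
  obtain ⟨s, hs, hs'⟩ := exists_compProj_eq_on hG l k.support
  refine ⟨s, fun i => ?_⟩
  by_cases hi : i ∈ k.support
  · exact hs i hi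
  · rw [hs' i hi]
    have := hl i
    rw [Finsupp.notMem_support_iff.1 hi, Nat.le_zero, FreeMonoid.length_eq_zero] at this
    exact this.symm

/-- An element with the letter counts of a factor of `s` is compatible with `s`. -/
theorem exists_factor (hG : ∀ i : Γ.CoconnectedComponent, i.EdgeFree)
    (s : Γ.RAArtinMonoid) (k : Γ.CoconnectedComponentTwo →₀ ℕ)
    (hk : ∀ i, k i ≤ (Γ.letterCount s).toAdd i) :
    ∃ r x, Γ.letterCount r = Multiplicative.ofAdd k ∧ CoreRel (r * x) s := by
  have hlen := fun i => (length_compProj hG i s)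
  -- Componentwise, `r` takes the prefixes of length `k i` and `x` the remaining suffixes.
  obtain ⟨r, hr⟩ := exists_compProj_eq hG
    (fun i => FreeMonoid.ofList ((compProj hG i.1 s).toList.take (k i))) k
    (fun i => List.length_take_le _ _)
  obtain ⟨x, hx⟩ := exists_compProj_eq hG
    (fun i => FreeMonoid.ofList ((compProj hG i.1 s).toList.drop (k i)))
    (Γ.letterCount s).toAdd (fun i => by
      rw [← hlen]
      exact (List.length_drop ..).le.trans (Nat.sub_le _ _))
  refine ⟨r, x, ?_, (coreRel_iff_compProj_eq hG).2 fun i => ?_⟩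
  · refine Multiplicative.toAdd.injective (Finsupp.ext fun i => ?_)
    rw [← length_compProj hG, hr]
    refine (List.length_take ..).trans (min_eq_left ?_)
    exact (hk i).trans (hlen i).ge
  · rw [map_mul, hr, hx, ← FreeMonoid.ofList_append, List.take_append_drop,
      FreeMonoid.ofList_toList]

/-- The number of classes of elements with prescribed letter counts. -/
theorem nat_card_quot_letterCount (hG : ∀ i : Γ.CoconnectedComponent, i.EdgeFree)
    (hfin : ∀ i : Γ.CoconnectedComponent, i.supp.Finite)
    (k : Γ.CoconnectedComponentTwo →₀ ℕ) (A : Set Γ.RAArtinMonoid)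
    (hA : ∀ s, s ∈ A ↔ Γ.letterCount s = Multiplicative.ofAdd k) :
    Nat.card (Quot fun s t : A => CoreRel (s : Γ.RAArtinMonoid) (t : Γ.RAArtinMonoid)) =
      sizeProd k := by
  have hlen : ∀ s ∈ A, ∀ i, (compProj hG i.1 s).length = k i := fun s hs i => by
    rw [length_compProj, (hA s).1 hs, toAdd_ofAdd]
  -- Outside the support of `k` all words are empty, so a finite product suffices.
  let Φ : (Quot fun s t : A => CoreRel (s : Γ.RAArtinMonoid) (t : Γ.RAArtinMonoid)) →
      ∀ i : k.support, List.Vector i.1.1.supp (k i.1) :=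
    Quot.lift (fun s i => ⟨(compProj hG i.1.1 s.1).toList, hlen s.1 s.2 i.1⟩) (by
      intro s t h
      funext i
      exact Subtype.ext (congrArg FreeMonoid.toList ((coreRel_iff_compProj_eq hG).1 h i.1)))
  have hΦ : Function.Bijective Φ := by
    constructor
    · rintro ⟨s⟩ ⟨t⟩ h
      refine Quot.sound ((coreRel_iff_compProj_eq hG).2 fun i => ?_)
      by_cases hi : i ∈ k.support
      · exact FreeMonoid.toList.injective (congrArg Subtype.val (congrFun h ⟨i, hi⟩))
      · have h0 := Finsupp.notMem_support_iff.1 hi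
        rw [FreeMonoid.length_eq_zero.1 ((hlen s s.2 i).trans h0),
          FreeMonoid.length_eq_zero.1 ((hlen t t.2 i).trans h0)]
    · intro f
      classical
      let l : ∀ i : Γ.CoconnectedComponentTwo, FreeMonoid i.1.supp := fun i =>
        if h : i ∈ k.support then FreeMonoid.ofList (f ⟨i, h⟩).1 else 1
      have hl : ∀ i, (l i).length = k i := fun i => by
        by_cases hi : i ∈ k.support
        · simp only [l, dif_pos hi]; exact (f ⟨i, hi⟩).2
        · simp only [l, dif_neg hi]; exact (Finsupp.notMem_support_iff.1 hi).symm
      obtain ⟨s, hs⟩ := exists_compProj_eq hG l k fun i => (hl i).le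
      refine ⟨Quot.mk _ ⟨s, (hA s).2 ?_⟩, ?_⟩
      · refine Multiplicative.toAdd.injective (Finsupp.ext fun i => ?_)
        rw [← length_compProj hG, hs, hl, toAdd_ofAdd]
      · funext i
        refine Subtype.ext ?_
        change (compProj hG i.1.1 s).toList = _
        rw [hs]
        simp only [l, dif_pos i.2]
        rfl
  have : ∀ i : k.support, Fintype i.1.1.supp := fun i => (hfin _).fintype
  rw [Nat.card_congr (Equiv.ofBijective Φ hΦ), Nat.card_pi, sizeProd, Finsupp.prod,
    ← Finset.prod_coe_sort k.support]
  refine Finset.prod_congr rfl fun i _ => ?_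
  rw [Nat.card_eq_fintype_card, card_vector, ← Nat.card_eq_fintype_card, Nat.card_coe_set_eq]

variable (Γ) in
/-- The homomorphism with value `|V_i|` at the vertices of `V_i`. -/
noncomputable def componentScale : Γ.RAArtinMonoid →* ℕ+ :=
  raArtinLift (fun v => Nat.toPNat' (Γᶜ.connectedComponentMk v).supp.ncard)
    fun _ _ _ => mul_comm _ _

theorem componentScale_gen (hfin : ∀ i : Γ.CoconnectedComponent, i.supp.Finite) (v : V) :
    (Γ.componentScale (Γ.gen v) : ℕ) = (Γᶜ.connectedComponentMk v).supp.ncard := by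
  have : 0 < (Γᶜ.connectedComponentMk v).supp.ncard :=
    (Set.ncard_pos (hfin _)).2 (ConnectedComponent.nonempty_supp _)
  simp only [componentScale, raArtinLift_gen, Nat.toPNat'_coe, if_pos this]

theorem isGeneralisedScale_componentScale (hG : ∀ i : Γ.CoconnectedComponent, i.EdgeFree)
    (hu : Γ.universalVertices ≠ Set.univ)
    (hfin : ∀ i : Γ.CoconnectedComponent, i.supp.Finite)
    (hr : RationallyIndependent (fun i : Γ.CoconnectedComponentTwo => i.1.supp.ncard)) :
    IsGeneralisedScale Γ.componentScale := by
  have hval := map_eq_sizeProd (componentScale_gen hfin)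
  -- Rational independence: the fibres of the scale are those of the letter count.
  have hlc : ∀ s t, Γ.letterCount s = Γ.letterCount t ↔
      Γ.componentScale s = Γ.componentScale t := fun s t => by
    constructor
    · intro h
      exact PNat.eq (by rw [hval, hval, h])
    · intro h
      by_contra hne
      refine hr _ _ (fun e => hne (Multiplicative.toAdd.injective e)) ?_
      have := congrArg PNat.val h
      rwa [hval, hval] at this
  have hcard : ∀ n ∈ Set.range Γ.componentScale,
      Nat.card (Quot fun s t : (Γ.componentScale ⁻¹' {n} : Set Γ.RAArtinMonoid) =>
        CoreRel (s : Γ.RAArtinMonoid) (t : Γ.RAArtinMonoid)) = (n : ℕ) := by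
    rintro _ ⟨s, rfl⟩
    rw [hval]
    exact nat_card_quot_letterCount hG hfin _ _ fun t => (hlc t s).symm
  refine ⟨fun h => ?_, hcard, ?_⟩
  · obtain ⟨v, hv⟩ := (Set.ne_univ_iff_exists_notMem _).1 hu
    have h2 := two_le_encard_supp_iff.2 hv
    rw [← (hfin _).cast_ncard_eq, ← componentScale_gen hfin, h,
      MonoidHom.one_apply, PNat.one_coe] at h2
    exact absurd h2 (by decide)
  · rintro _ ⟨s, rfl⟩ T hT
    -- Accuracy: in each component, `f` and `f'` project to prefixes of equal length of the same
    -- word.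
    refine ⟨fun f hf f' hf' hne x y e => ?_, ?_, fun t => ?_⟩
    · refine hne (hT.eq_of_coreRel (coreRel_equiv Γ) hf hf'
        ((coreRel_iff_compProj_eq hG).2 fun i => ?_))
      have hl := (hlc f f').2 ((hT.1 hf).trans (hT.1 hf').symm)
      have hi := congrArg (compProj hG i.1) e
      rw [map_mul, map_mul] at hi
      refine FreeMonoid.toList.injective (List.append_inj_left (congrArg FreeMonoid.toList hi) ?_)
      have := length_compProj hG i f
      rw [hl, ← length_compProj hG i f'] at this
      exact this
    · refine Set.finite_coe_iff.1 (Nat.finite_of_card_ne_zero ?_)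
      rw [hT.nat_card (coreRel_equiv Γ), hcard _ ⟨s, rfl⟩]
      exact (PNat.pos _).ne'
    · obtain ⟨r, x, hr, hrx⟩ := exists_factor hG (t * s) (Γ.letterCount s).toAdd
        fun i => by rw [map_mul, toAdd_mul, Finsupp.add_apply]; exact Nat.le_add_left _ _
      obtain ⟨f, ⟨hf, hrf⟩, -⟩ := hT.2 r ((hlc r s).1 hr)
      refine ⟨f, hf, not_orthogonal_iff.2 ?_⟩
      have : CoreRel (f * x) (t * s) := by
        refine (coreRel_equiv Γ).trans ((coreRel_iff_compProj_eq hG).2 fun i => ?_) hrx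
        rw [map_mul, map_mul, (coreRel_iff_compProj_eq hG).1 hrf i]
      obtain ⟨a, -, b, -, e⟩ := this
      exact ⟨x * a, s * b, by rw [← mul_assoc, e, mul_assoc]⟩

end Existence

end SimpleGraph

theorem mainTheorem6 {V : Type*} [Countable V] (Γ : SimpleGraph V) :
    ((∃ N : Γ.RAArtinMonoid →* ℕ+, GenScale.IsGeneralisedScale N) ↔
      (Γ.universalVertices ≠ Set.univ ∧
        (∀ i : Γ.CoconnectedComponent, i.supp.Finite ∧ i.EdgeFree) ∧
        RationallyIndependent (fun i : Γ.CoconnectedComponentTwo => i.1.supp.ncard))) ∧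
    (∀ N N' : Γ.RAArtinMonoid →* ℕ+,
      GenScale.IsGeneralisedScale N → GenScale.IsGeneralisedScale N' → N = N') := by
  refine ⟨⟨?_, ?_⟩, fun N N' hN hN' => SimpleGraph.scale_unique hN hN'⟩
  · rintro ⟨N, hN⟩
    refine ⟨SimpleGraph.universalVertices_ne_univ_of_scale hN, fun i => ⟨?_, ?_⟩,
      SimpleGraph.rationallyIndependent_of_scale hN⟩
    · obtain ⟨v, rfl⟩ := i.exists_rep
      exact (SimpleGraph.finite_and_scale_gen hN v).1
    · exact SimpleGraph.edgeFree_of_scale hN i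
  · rintro ⟨hu, hi, hr⟩
    exact ⟨Γ.componentScale, SimpleGraph.isGeneralisedScale_componentScale (fun i => (hi i).2) hu
      (fun i => (hi i).1) hr⟩
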